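/- Let $n\ge 1$, $0\le\gamma<1$ and $\alpha=\frac{4}{3+\gamma}$; let $B_r(x)\subset\mathbb R^n$ be the open ball, $B_r=B_r(0)$, and $\Delta_\infty u=\sum_{i,j}D_{ij}u\,D_iu\,D_ju$. For every $M\ge 0$ and $d\in(0,1]$ there are constants $C>0$ and $0<\kappa_0\le d$, depending only on $n,\gamma,M,d$, with the following property. Let $\delta>0$ and let $\mathcal B:\mathbb R\to\mathbb R$ be a Lipschitz function with $0\le\mathcal B(s)\le 1$ for $s\ge 0$, $\mathcal B(s)=0$ for $s\le\delta/2$ and $\mathcal B(s)=1$ for $s\ge\delta$; let $\varepsilon>0$ and $\mathcal B_\varepsilon(s)=\mathcal B(s/\varepsilon^\alpha)$. Let $v$ be a nonnegative continuous viscosity solution of $$\Delta_\infty v=\mathcal B_\varepsilon(v)\,v^{-\gamma}\quad\text{in }B_1$$ with $\sup_{B_1}v\le M$ (the right-hand side is understood as $0$ where $v=0$). Then for every $x$ with $|x|\le 1-d$ (that is, $x\in B_1$ with $\operatorname{dist}(x,\partial B_1)\ge d$) and every $\kappa$ with $$v(x)^{1/\alpha}\le\kappa\le\kappa_0$$ one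 has $$\sup_{B_\kappa(x)}v\le C\,\kappa^\alpha .$$ In particular $C$ and $\kappa_0$ do not depend on $\varepsilon$ (nor on $\delta$ and $\mathcal B$). -/

import Mathlib

noncomputable section

namespace InfLap

/-- The partial derivative `D_i u` in the `i`-th coordinate direction. -/
def partialDeriv {n : ℕ} (i : Fin n) (u : EuclideanSpace ℝ (Fin n) → ℝ)
    (x : EuclideanSpace ℝ (Fin n)) : ℝ :=
  fderiv ℝ u x (EuclideanSpace.single i (1 : ℝ))

/-- The infinity Laplacian `Δ_∞ u = ∑_{i,j} D_{ij}u D_i u D_j u`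
(used below only at points where `u` is `C²`). -/
def infLaplacian {n : ℕ} (u : EuclideanSpace ℝ (Fin n) → ℝ)
    (x : EuclideanSpace ℝ (Fin n)) : ℝ :=
  ∑ i : Fin n, ∑ j : Fin n,
    partialDeriv i (partialDeriv j u) x * partialDeriv i u x * partialDeriv j u x

/-- `u` is a viscosity subsolution, `Δ_∞ u ≥ f(u)`, in the open set `Ω`: every `C²` function
touching `u` from above at a point of `Ω` satisfies the inequality at that point. -/
def IsViscositySubsolution {n : ℕ} (Ω : Set (EuclideanSpace ℝ (Fin n))) (f : ℝ → ℝ)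
    (u : EuclideanSpace ℝ (Fin n) → ℝ) : Prop :=
  ∀ x₀ ∈ Ω, ∀ φ : EuclideanSpace ℝ (Fin n) → ℝ, ContDiffAt ℝ 2 φ x₀ →
    IsLocalMax (fun x => u x - φ x) x₀ → f (u x₀) ≤ infLaplacian φ x₀

/-- `u` is a viscosity supersolution, `Δ_∞ u ≤ f(u)`, in the open set `Ω`: every `C²` function
touching `u` from below at a point of `Ω` satisfies the inequality at that point. -/
def IsViscositySupersolution {n : ℕ} (Ω : Set (EuclideanSpace ℝ (Fin n))) (f : ℝ → ℝ)
    (u : EuclideanSpace ℝ (Fin n) → ℝ) : Prop :=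
  ∀ x₀ ∈ Ω, ∀ φ : EuclideanSpace ℝ (Fin n) → ℝ, ContDiffAt ℝ 2 φ x₀ →
    IsLocalMin (fun x => u x - φ x) x₀ → infLaplacian φ x₀ ≤ f (u x₀)

/-- `u` is a (continuous) viscosity solution of `Δ_∞ u = f(u)` in the open set `Ω`. Only the
values of `u` on `Ω` matter. -/
structure IsViscositySolution {n : ℕ} (Ω : Set (EuclideanSpace ℝ (Fin n))) (f : ℝ → ℝ)
    (u : EuclideanSpace ℝ (Fin n) → ℝ) : Prop where
  continuousOn : ContinuousOn u Ω
  subsolution : IsViscositySubsolution Ω f u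
  supersolution : IsViscositySupersolution Ω f u

/-- The exponent `α = 4 / (3 + γ)`. -/
def alphaExp (γ : ℝ) : ℝ := 4 / (3 + γ)

/-- The Lipschitz profiles `B` approximating the characteristic function of `(0, ∞)`. -/
structure IsCutoff (δ : ℝ) (B : ℝ → ℝ) : Prop where
  lipschitz : ∃ K : NNReal, LipschitzWith K B
  mem_Icc : ∀ s : ℝ, 0 ≤ s → 0 ≤ B s ∧ B s ≤ 1
  eq_zero : ∀ s : ℝ, s ≤ δ / 2 → B s = 0
  eq_one : ∀ s : ℝ, δ ≤ s → B s = 1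

/-- The rescaled profile `B_ε(s) = B(s / ε^α)`. -/
def cutoffScaled (γ : ℝ) (B : ℝ → ℝ) (ε s : ℝ) : ℝ := B (s / ε ^ alphaExp γ)

/-- The source term `s ↦ B_ε(s) s^{-γ}`, which vanishes for `0 ≤ s ≤ (δ/2) ε^α`. -/
def singularSource (γ : ℝ) (B : ℝ → ℝ) (ε s : ℝ) : ℝ := cutoffScaled γ B ε s * s ^ (-γ)

end InfLap

end

namespace InfLap

open Filter Topology

variable {n : ℕ}

/-! The supersolution property alone gives this Harnack-type bound. For small `s > 0` put `w = (v +
s) ^ (1 / α)`. Since `3 * α - 4 = -α * γ`, the `α`-th power of a cone of slope `A` has infinity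
Laplacian equal to its own `(-γ)`-th power times `α ^ 3 * (α - 1) * A ^ 4`
(`infLaplacian_conePower`). For `A` large this beats the source (`singularSource_le`), so `w` admits
no such cone touching from below off its vertex (`cone_comparison`). Given `y` near `x`, take the
cone with vertex value `w y` falling to `s ^ (1 / α)` at distance `2 * κ`. Either its slope is
bounded, so that `w y` is of order `κ`, or comparison at `x` gives `w y ≤ 2 * w x`, again of order
`κ`. -/

/-- The infinity Laplacian of a radial function, written as a function of the squared distance. -/
theorem infLaplacian_comp_dist_sq {F F' : ℝ → ℝ} {F'' : ℝ} {y z : EuclideanSpace ℝ (Fin n)}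
    (h₁ : ∀ᶠ q in 𝓝 (‖z - y‖ ^ 2), HasDerivAt F (F' q) q)
    (h₂ : HasDerivAt F' F'' (‖z - y‖ ^ 2)) :
    infLaplacian (fun w => F (‖w - y‖ ^ 2)) z =
      16 * F' (‖z - y‖ ^ 2) ^ 2 * F'' * (‖z - y‖ ^ 2) ^ 2
        + 8 * F' (‖z - y‖ ^ 2) ^ 3 * ‖z - y‖ ^ 2 := by
  have hq : ∀ w : EuclideanSpace ℝ (Fin n),
      HasFDerivAt (fun w => ‖w - y‖ ^ 2) (2 • innerSL ℝ (w - y)) w := fun w => by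
    simpa using ((hasFDerivAt_id w).sub_const y).norm_sq
  have hcoord : ∀ (w : EuclideanSpace ℝ (Fin n)) (i : Fin n),
      (2 • innerSL ℝ (w - y)) (EuclideanSpace.single i (1 : ℝ)) = 2 * (w - y) i := fun w i => by
    simp [EuclideanSpace.inner_single_right]
  have hcont : Tendsto (fun w : EuclideanSpace ℝ (Fin n) => ‖w - y‖ ^ 2) (𝓝 z)
      (𝓝 (‖z - y‖ ^ 2)) := (hq z).continuousAt
  have hgrad : ∀ j : Fin n, ∀ᶠ w in 𝓝 z,
      partialDeriv j (fun w => F (‖w - y‖ ^ 2)) w = F' (‖w - y‖ ^ 2) * (2 * (w - y) j) := by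
    intro j
    filter_upwards [hcont.eventually h₁] with w hw
    have := (hw.comp_hasFDerivAt w (hq w)).fderiv
    rw [partialDeriv]
    erw [this]
    rw [_root_.smul_apply, hcoord, smul_eq_mul]
  have hhess : ∀ i j : Fin n,
      partialDeriv i (partialDeriv j (fun w => F (‖w - y‖ ^ 2))) z =
        F'' * (2 * (z - y) i) * (2 * (z - y) j)
          + F' (‖z - y‖ ^ 2) * (2 * if j = i then 1 else 0) := by
    intro i j
    have hlin : HasFDerivAt (fun w : EuclideanSpace ℝ (Fin n) => 2 * (w - y) j)
        ((2 : ℝ) • (EuclideanSpace.proj j : EuclideanSpace ℝ (Fin n) →L[ℝ] ℝ)) z := by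
      have := ((EuclideanSpace.proj j : EuclideanSpace ℝ (Fin n) →L[ℝ] ℝ).hasFDerivAt
        (x := z)).sub_const (y j)
      simpa using this.const_mul (2 : ℝ)
    have hprod := (h₂.comp_hasFDerivAt z (hq z)).mul hlin
    rw [partialDeriv, Filter.EventuallyEq.fderiv_eq (hgrad j)]
    erw [hprod.fderiv]
    rw [_root_.add_apply, _root_.smul_apply,
      _root_.smul_apply, _root_.smul_apply,
      _root_.smul_apply, hcoord]
    simp only [smul_eq_mul, Function.comp_apply, PiLp.proj_apply,
      PiLp.single_apply]
    ring
  have hnorm : ∑ i : Fin n, (z - y) i ^ 2 = ‖z - y‖ ^ 2 := by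
    rw [EuclideanSpace.real_norm_sq_eq]
  set Q := ‖z - y‖ ^ 2 with hQ
  have hsum : ∀ i : Fin n, ∑ j : Fin n,
      partialDeriv i (partialDeriv j (fun w => F (‖w - y‖ ^ 2))) z *
        partialDeriv i (fun w => F (‖w - y‖ ^ 2)) z *
        partialDeriv j (fun w => F (‖w - y‖ ^ 2)) z =
      (16 * F' Q ^ 2 * F'' * Q + 8 * F' Q ^ 3) * (z - y) i ^ 2 := by
    intro i
    have : ∀ j : Fin n, partialDeriv i (partialDeriv j (fun w => F (‖w - y‖ ^ 2))) z *
        partialDeriv i (fun w => F (‖w - y‖ ^ 2)) z *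
        partialDeriv j (fun w => F (‖w - y‖ ^ 2)) z =
        16 * F' Q ^ 2 * F'' * (z - y) i ^ 2 * (z - y) j ^ 2
          + if j = i then 8 * F' Q ^ 3 * (z - y) i ^ 2 else 0 := by
      intro j
      rw [hhess i j, (hgrad i).self_of_nhds, (hgrad j).self_of_nhds]
      split_ifs with hij
      · subst hij; ring
      · ring
    rw [Finset.sum_congr rfl fun j _ => this j, Finset.sum_add_distrib, ← Finset.mul_sum, hnorm,
      Finset.sum_ite_eq' Finset.univ i, if_pos (Finset.mem_univ i)]
    ring
  rw [infLaplacian, Finset.sum_congr rfl fun i _ => hsum i, ← Finset.mul_sum, hnorm]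
  ring

/-- Powers of a cone: the test functions used for comparison from below. -/
noncomputable def conePower (α b A s : ℝ) (y w : EuclideanSpace ℝ (Fin n)) : ℝ :=
  (b - A * √(‖w - y‖ ^ 2)) ^ α - s

theorem contDiffAt_conePower {α b A s : ℝ} {y z : EuclideanSpace ℝ (Fin n)} (hzy : z ≠ y)
    (hpos : 0 < b - A * ‖z - y‖) : ContDiffAt ℝ 2 (conePower α b A s y) z := by
  have hq : ContDiffAt ℝ 2 (fun w : EuclideanSpace ℝ (Fin n) => ‖w - y‖ ^ 2) z :=
    (contDiffAt_id.sub contDiffAt_const).norm_sq ℝ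
  have h0 : ‖z - y‖ ^ 2 ≠ 0 := pow_ne_zero 2 (norm_ne_zero_iff.2 (sub_ne_zero.2 hzy))
  have hs : ContDiffAt ℝ 2 (fun w : EuclideanSpace ℝ (Fin n) => √(‖w - y‖ ^ 2)) z := hq.sqrt h0
  refine ContDiffAt.sub (ContDiffAt.rpow_const_of_ne
    (contDiffAt_const.sub (contDiffAt_const.mul hs)) ?_) contDiffAt_const
  simpa [Real.sqrt_sq (norm_nonneg (z - y))] using hpos.ne'

theorem infLaplacian_conePower {α b A s : ℝ} {y z : EuclideanSpace ℝ (Fin n)} (hzy : z ≠ y)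
    (hpos : 0 < b - A * ‖z - y‖) :
    infLaplacian (conePower α b A s y) z =
      α ^ 3 * (α - 1) * A ^ 4 * (b - A * ‖z - y‖) ^ (3 * α - 4) := by
  have hr : 0 < ‖z - y‖ := norm_pos_iff.2 (sub_ne_zero.2 hzy)
  have hsq : √(‖z - y‖ ^ 2) = ‖z - y‖ := Real.sqrt_sq hr.le
  have hbase : ∀ q : ℝ, 0 < q → HasDerivAt (fun q => b - A * √q) (-(A / (2 * √q))) q := by
    intro q hq
    refine (((Real.hasDerivAt_sqrt hq.ne').const_mul A).const_sub b).congr_deriv ?_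
    ring
  have hpow : ∀ (p q : ℝ), 0 < q → 0 < b - A * √q →
      HasDerivAt (fun q => (b - A * √q) ^ p)
        (-(A / (2 * √q)) * p * (b - A * √q) ^ (p - 1)) q :=
    fun p q hq hu => (hbase q hq).rpow_const (Or.inl hu.ne')
  have hq0 : 0 < ‖z - y‖ ^ 2 := by positivity
  have hu0 : 0 < b - A * √(‖z - y‖ ^ 2) := by rwa [hsq]
  have h₁ : ∀ᶠ q in 𝓝 (‖z - y‖ ^ 2), HasDerivAt (fun q => (b - A * √q) ^ α - s)
      (-(A / (2 * √q)) * α * (b - A * √q) ^ (α - 1)) q := by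
    have hc : ContinuousAt (fun q => b - A * √q) (‖z - y‖ ^ 2) := (hbase _ hq0).continuousAt
    filter_upwards [lt_mem_nhds hq0, hc.eventually (lt_mem_nhds hu0)] with q hq hu
    exact (hpow α q hq hu).sub_const s
  have hinv : HasDerivAt (fun q => -(A / (2 * √q)) * α)
      (A * α / (4 * ‖z - y‖ ^ 3)) (‖z - y‖ ^ 2) := by
    have := ((((Real.hasDerivAt_sqrt hq0.ne').const_mul 2).fun_inv
      (by rw [hsq]; positivity)).const_mul (-(A * α)))
    refine (this.congr_deriv ?_).congr_of_eventuallyEq (Eventually.of_forall fun q => ?_)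
    · rw [hsq]; field_simp; ring
    · simp only [div_eq_mul_inv]; ring
  have h₂ := hinv.mul (hpow (α - 1) _ hq0 hu0)
  have key := infLaplacian_comp_dist_sq (F := fun q => (b - A * √q) ^ α - s)
    (F' := fun q => -(A / (2 * √q)) * α * (b - A * √q) ^ (α - 1)) h₁ h₂
  have hfun : conePower α b A s y = fun w => (fun q => (b - A * √q) ^ α - s) (‖w - y‖ ^ 2) := rfl
  rw [hfun, key]
  simp only [hsq]
  set r := ‖z - y‖
  set u := b - A * r
  have e1 : u ^ (α - 1) = u ^ (α - 1 - 1) * u := by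
    rw [← Real.rpow_add_one hpos.ne']; congr 1; ring
  have e2 : u ^ (3 * α - 4) = (u ^ (α - 1 - 1)) ^ 3 * u ^ 2 := by
    rw [← Real.rpow_mul_natCast hpos.le, ← Real.rpow_natCast u 2, ← Real.rpow_add hpos]
    congr 1; push_cast; ring
  rw [e2, e1]
  field_simp
  ring

/-- Comparison with cones from below for `(v + s) ^ (1 / α)`. -/
theorem cone_comparison {γ α D s ρ : ℝ} {f : ℝ → ℝ} {v : EuclideanSpace ℝ (Fin n) → ℝ}
    {Ω : Set (EuclideanSpace ℝ (Fin n))} {y : EuclideanSpace ℝ (Fin n)}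
    (hα : 0 < α) (hαγ : α * (3 + γ) = 4) (hs : 0 < s) (hρ : 0 < ρ)
    (hv : ContinuousOn v Ω) (hsup : IsViscositySupersolution Ω f v)
    (hv0 : ∀ x ∈ Ω, 0 ≤ v x) (hball : Metric.closedBall y ρ ⊆ Ω)
    (hf : ∀ t, 0 ≤ t → f t ≤ D * (t + s) ^ (-γ)) {A : ℝ} (hA : 0 < A)
    (hAy : A * ρ = (v y + s) ^ (1 / α) - s ^ (1 / α))
    (hD : D < α ^ 3 * (α - 1) * A ^ 4) {z : EuclideanSpace ℝ (Fin n)}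
    (hz : z ∈ Metric.closedBall y ρ) :
    (v y + s) ^ (1 / α) - A * ‖z - y‖ ≤ (v z + s) ^ (1 / α) := by
  set h : EuclideanSpace ℝ (Fin n) → ℝ := fun w => (v w + s) ^ (1 / α) + A * ‖w - y‖ with hh
  have hcont : ContinuousOn h (Metric.closedBall y ρ) := by
    refine ContinuousOn.add (ContinuousOn.rpow_const ((hv.mono hball).add continuousOn_const)
      fun w _ => Or.inr (by positivity)) ?_
    fun_prop
  obtain ⟨p, hp, hmin⟩ := (isCompact_closedBall y ρ).exists_isMinOn
    (Metric.nonempty_closedBall.2 hρ.le) hcont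
  suffices hle : h y ≤ h p by
    have h1 := hmin hz
    simp only [Set.mem_ofPred_eq] at h1
    have : h y = (v y + s) ^ (1 / α) := by simp [hh]
    simp only [hh] at h1 hle this
    linarith
  by_contra! hlt
  have hhy : h y = (v y + s) ^ (1 / α) := by simp [hh]
  have hpy : p ≠ y := by rintro rfl; exact lt_irrefl _ hlt
  have hvp : 0 ≤ v p := hv0 p (hball hp)
  -- By `hAy`, `h ≥ h y` on the sphere of radius `ρ`, so a smaller minimum is interior.
  have hpball : p ∈ Metric.ball y ρ := by
    rw [Metric.mem_ball, dist_eq_norm]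
    have hmono : s ^ (1 / α) ≤ (v p + s) ^ (1 / α) :=
      Real.rpow_le_rpow hs.le (by linarith) (by positivity)
    have : A * ‖p - y‖ < A * ρ := by
      rw [hhy] at hlt; simp only [hh] at hlt; linarith
    exact lt_of_mul_lt_mul_left this hA.le
  set b := h p with hb
  have hbp : b - A * ‖p - y‖ = (v p + s) ^ (1 / α) := by simp [hb, hh]
  have hpos : 0 < b - A * ‖p - y‖ := by rw [hbp]; positivity
  have hpow : ∀ t : ℝ, 0 ≤ t → (t ^ (1 / α)) ^ α = t := fun t ht => by
    rw [← Real.rpow_mul ht, one_div_mul_cancel hα.ne', Real.rpow_one]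
  have hcone : ∀ w, conePower α b A s y w = (b - A * ‖w - y‖) ^ α - s := fun w => by
    rw [conePower, Real.sqrt_sq (norm_nonneg _)]
  -- Minimality of `h` at `p` puts the cone of height `b` below `(v + s) ^ (1 / α)`, with contact at
  -- `p`; the `α`-th power preserves this.
  have htouch : IsLocalMin (fun x => v x - conePower α b A s y x) p := by
    have hc : ContinuousAt (fun w => b - A * ‖w - y‖) p := by fun_prop
    filter_upwards [Metric.isOpen_ball.mem_nhds hpball, hc.eventually (lt_mem_nhds hpos)]
      with w hw hwpos
    have hwv : 0 ≤ v w := hv0 w (hball (Metric.ball_subset_closedBall hw))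
    have h1 : b ≤ h w := hmin (Metric.ball_subset_closedBall hw)
    have h2 : (b - A * ‖w - y‖) ^ α ≤ ((v w + s) ^ (1 / α)) ^ α :=
      Real.rpow_le_rpow hwpos.le (by simp only [hh] at h1; linarith) hα.le
    rw [hpow _ (by positivity)] at h2
    rw [hcone, hcone, hbp, hpow _ (by positivity)]
    linarith
  have hvisc := hsup p (hball hp) _ (contDiffAt_conePower hpy hpos) htouch
  rw [infLaplacian_conePower hpy hpos, hbp, ← Real.rpow_mul (by positivity)] at hvisc
  have hexp : 1 / α * (3 * α - 4) = -γ := by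
    field_simp; linarith
  rw [hexp] at hvisc
  have hlast := hvisc.trans (hf _ hvp)
  have : 0 < (v p + s) ^ (-γ) := by positivity
  exact absurd hlast (not_le.2 (mul_lt_mul_of_pos_right hD this))

/-- The shift `s` lies in the range where the cutoff vanishes. Beyond it `t + s ≤ 2 * t`, so
replacing `t` by `t + s` costs at most `2 ^ γ ≤ 2`, whatever `ε`, `δ` and `B` are. -/
theorem singularSource_le {γ δ ε s t : ℝ} {B : ℝ → ℝ} (hγ0 : 0 ≤ γ) (hγ1 : γ ≤ 1)
    (hB : IsCutoff δ B) (hε : 0 < ε) (hs : 0 < s) (hsδ : s ≤ δ / 2 * ε ^ alphaExp γ)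
    (ht : 0 ≤ t) : singularSource γ B ε t ≤ 2 * (t + s) ^ (-γ) := by
  have hεα : 0 < ε ^ alphaExp γ := Real.rpow_pos_of_pos hε _
  rw [singularSource, cutoffScaled]
  rcases le_total t s with hts | hst
  · rw [hB.eq_zero _ (by rw [div_le_iff₀ hεα]; linarith), zero_mul]
    positivity
  · have ht' : 0 < t := hs.trans_le hst
    have h1 : (t + s) ^ γ ≤ 2 * t ^ γ := calc
      (t + s) ^ γ ≤ (2 * t) ^ γ := Real.rpow_le_rpow (by positivity) (by linarith) hγ0
      _ = 2 ^ γ * t ^ γ := Real.mul_rpow (by norm_num) ht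
      _ ≤ 2 ^ (1 : ℝ) * t ^ γ := by gcongr; norm_num
      _ = 2 * t ^ γ := by rw [Real.rpow_one]
    have h2 : t ^ (-γ) ≤ 2 * (t + s) ^ (-γ) := by
      rw [Real.rpow_neg ht, Real.rpow_neg (by positivity), ← div_eq_mul_inv,
        le_div_iff₀ (by positivity), inv_mul_le_iff₀ (by positivity)]
      linarith
    have h3 := (hB.mem_Icc (t / ε ^ alphaExp γ) (by positivity)).2
    have h4 : 0 ≤ t ^ (-γ) := by positivity
    exact (mul_le_of_le_one_left h4 h3).trans h2

end InfLap

theorem theorem3p1 (n : ℕ) (γ : ℝ) (hγ0 : 0 ≤ γ) (hγ1 : γ < 1) (M d : ℝ) (hd : 0 < d) :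
    ∃ C κ₀ : ℝ, 0 < C ∧ 0 < κ₀ ∧ κ₀ ≤ d ∧
      ∀ (δ : ℝ) (B : ℝ → ℝ) (ε : ℝ) (v : EuclideanSpace ℝ (Fin n) → ℝ),
        0 < δ → InfLap.IsCutoff δ B → 0 < ε →
        InfLap.IsViscositySolution (Metric.ball 0 1) (InfLap.singularSource γ B ε) v →
        (∀ x ∈ Metric.ball (0 : EuclideanSpace ℝ (Fin n)) 1, 0 ≤ v x ∧ v x ≤ M) →
        ∀ (x : EuclideanSpace ℝ (Fin n)) (κ : ℝ), ‖x‖ ≤ 1 - d →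
          v x ^ (1 / InfLap.alphaExp γ) ≤ κ → κ ≤ κ₀ →
          ∀ y ∈ Metric.ball x κ, v y ≤ C * κ ^ InfLap.alphaExp γ := by
  obtain ⟨α, hαdef⟩ : ∃ α, α = InfLap.alphaExp γ := ⟨_, rfl⟩
  have hαγ : α * (3 + γ) = 4 := by
    rw [hαdef, InfLap.alphaExp]; field_simp
  have hα1 : 1 < α := by
    rw [hαdef, InfLap.alphaExp, lt_div_iff₀ (by linarith)]; linarith
  have hα : 0 < α := by linarith
  have hm : 0 < α ^ 3 * (α - 1) := mul_pos (by positivity) (by linarith)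
  obtain ⟨A₀, hA₀⟩ : ∃ A₀, A₀ = 2 / (α ^ 3 * (α - 1)) + 1 := ⟨_, rfl⟩
  have hA₀1 : 1 ≤ A₀ := by rw [hA₀]; linarith [div_pos two_pos hm]
  have hbig : ∀ A, A₀ ≤ A → 2 < α ^ 3 * (α - 1) * A ^ 4 := fun A hA => calc
    2 < α ^ 3 * (α - 1) * A₀ := by
      rw [hA₀, mul_add, mul_div_cancel₀ _ hm.ne']; linarith
    _ ≤ α ^ 3 * (α - 1) * A := by gcongr
    _ ≤ α ^ 3 * (α - 1) * A ^ 4 := by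
      gcongr; exact le_self_pow₀ (hA₀1.trans hA) (by norm_num)
  -- The two summands serve the two slope cases. With `κ ≤ d / 4`, the ball of radius `2 * κ` about
  -- `y` stays within `3 * κ < d` of `x`.
  refine ⟨(2 * A₀ + 1) ^ α + 2 ^ α * 2, d / 4, by positivity, by positivity, by linarith, ?_⟩
  intro δ B ε v hδ hB hε hsol hbd x κ hx hvx hκ y hy
  rw [← hαdef] at hvx ⊢
  have hxy : ‖x - y‖ < κ := by rw [← dist_eq_norm, dist_comm]; exact hy
  have hκ0 : 0 < κ := (norm_nonneg _).trans_lt hxy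
  have hball : Metric.closedBall y (2 * κ) ⊆ Metric.ball (0 : EuclideanSpace ℝ (Fin n)) 1 := by
    intro w hw
    rw [Metric.mem_closedBall, dist_eq_norm] at hw
    rw [mem_ball_zero_iff]
    have h1 : ‖w‖ ≤ ‖w - y‖ + ‖x - y‖ + ‖x‖ := by
      have e : w = (w - y) - (x - y) + x := by abel
      calc ‖w‖ = ‖(w - y) - (x - y) + x‖ := by rw [← e]
        _ ≤ _ := (norm_add_le _ _).trans (by gcongr; exact norm_sub_le _ _)
    linarith
  have hv0 : ∀ w ∈ Metric.ball (0 : EuclideanSpace ℝ (Fin n)) 1, 0 ≤ v w := fun w hw =>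
    (hbd w hw).1
  have hvy0 := hv0 y (hball (Metric.mem_closedBall_self (by positivity)))
  have hxmem : x ∈ Metric.closedBall y (2 * κ) := by
    rw [Metric.mem_closedBall, dist_eq_norm]; linarith
  have hvx0 := hv0 x (hball hxmem)
  have hκα : 0 < κ ^ α := by positivity
  have hinv : ∀ t : ℝ, 0 ≤ t → (t ^ (1 / α)) ^ α = t := fun t ht => by
    rw [← Real.rpow_mul ht, one_div_mul_cancel hα.ne', Real.rpow_one]
  have hvxκ : v x ≤ κ ^ α := by
    rw [← hinv (v x) hvx0]; exact Real.rpow_le_rpow (by positivity) hvx hα.le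
  -- The first bound absorbs the cutoff; the second keeps the shift of order `κ ^ α`.
  obtain ⟨s, hsdef⟩ : ∃ s, s = min (δ / 2 * ε ^ InfLap.alphaExp γ) (κ ^ α) := ⟨_, rfl⟩
  have hs : 0 < s := by rw [hsdef]; exact lt_min (by positivity) hκα
  have hsδ : s ≤ δ / 2 * ε ^ InfLap.alphaExp γ := by rw [hsdef]; exact min_le_left _ _
  have hsκ : s ≤ κ ^ α := by rw [hsdef]; exact min_le_right _ _
  have hσκ : s ^ (1 / α) ≤ κ := by
    calc s ^ (1 / α) ≤ (κ ^ α) ^ (1 / α) := Real.rpow_le_rpow hs.le hsκ (by positivity)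
      _ = κ := by rw [← Real.rpow_mul hκ0.le, mul_one_div_cancel hα.ne', Real.rpow_one]
  have hσ : 0 < s ^ (1 / α) := by positivity
  have hC1 : 0 ≤ (2 * A₀ + 1) ^ α * κ ^ α := by positivity
  have hC2 : 0 ≤ 2 ^ α * 2 * κ ^ α := by positivity
  obtain ⟨A, hA⟩ : ∃ A, A = ((v y + s) ^ (1 / α) - s ^ (1 / α)) / (2 * κ) := ⟨_, rfl⟩
  have hAy : A * (2 * κ) = (v y + s) ^ (1 / α) - s ^ (1 / α) := by
    rw [hA]; field_simp
  rw [add_mul]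
  rcases lt_or_ge A A₀ with hlt | hge
  · have h1 : (v y + s) ^ (1 / α) ≤ (2 * A₀ + 1) * κ := by
      have : A * (2 * κ) ≤ A₀ * (2 * κ) := by gcongr
      linarith
    have h2 := Real.rpow_le_rpow (by positivity) h1 hα.le
    rw [hinv _ (by positivity), Real.mul_rpow (by positivity) hκ0.le] at h2
    linarith
  · have hA0 : 0 < A := by linarith
    have hcmp := InfLap.cone_comparison hα hαγ hs (by positivity : 0 < 2 * κ)
      hsol.continuousOn hsol.supersolution hv0 hball
      (fun t ht => InfLap.singularSource_le hγ0 hγ1.le hB hε hs hsδ ht) hA0 hAy (hbig A hge) hxmem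
    -- Since `x` is less than half the radius from `y`, the cone has lost at most half its height
    -- there.
    have h1 : (v y + s) ^ (1 / α) ≤ 2 * (v x + s) ^ (1 / α) := by
      have : A * ‖x - y‖ ≤ A * κ := by gcongr
      linarith
    have h2 := Real.rpow_le_rpow (by positivity) h1 hα.le
    rw [hinv _ (by positivity), Real.mul_rpow (by positivity) (by positivity),
      hinv _ (by positivity)] at h2
    have h3 : (2 : ℝ) ^ α * (v x + s) ≤ 2 ^ α * (2 * κ ^ α) := by gcongr; linarith
    linarith
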